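/- For integers $2\le k\le n$, let $\mathcal S^n_+$ be the cone of real symmetric positive semidefinite (PSD) $n\times n$ matrices, and let $\mathcal S^{n,k}$ (the $k$-PSD closure) be the set of all real symmetric $n\times n$ matrices all of whose $k\times k$ principal submatrices are PSD. With $\|\cdot\|_F$ the Frobenius norm, put $$\overline{\mathrm{dist}}_F(\mathcal S^{n,k},\mathcal S^n_+)=\sup_{M\in\mathcal S^{n,k},\ \|M\|_F=1}\ \inf_{N\in\mathcal S^n_+}\|M-N\|_F .$$ Fix a constant $r<\frac1{93}$. Then for all integers $n$ and $k$ with $k=rn$ and $k\ge 2$, $$\overline{\mathrm{dist}}_F(\mathcal S^{n,k},\mathcal S^n_+)>\frac{\sqrt{r-93r^2}}{\sqrt{162r+3}},$$ a bound which is independent of $n$. -/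

import Mathlib

/-! Matrices carry the Frobenius norm `‖M‖ = (∑ i, ∑ j, |M i j| ^ 2) ^ (1 / 2)` and its metric. -/
attribute [local instance] Matrix.frobeniusNormedAddCommGroup

/-- The cone of real symmetric positive semidefinite `n × n` matrices. -/
def psdCone (n : ℕ) : Set (Matrix (Fin n) (Fin n) ℝ) :=
  {M | M.PosSemidef}

/-- The `k`-PSD closure: the real symmetric `n × n` matrices all of whose `k × k` principal
submatrices are positive semidefinite. -/
def kPSDClosure (n k : ℕ) : Set (Matrix (Fin n) (Fin n) ℝ) :=
  {M | M.IsSymm ∧ ∀ J : Finset (Fin n), J.card = k →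
    (M.submatrix (fun i : J => (i : Fin n)) (fun i : J => (i : Fin n))).PosSemidef}

/-- The Frobenius distance from `M` to the PSD cone: the infimum of `‖M - N‖` over the
positive semidefinite matrices `N`. -/
noncomputable def distPSD {n : ℕ} (M : Matrix (Fin n) (Fin n) ℝ) : ℝ :=
  ⨅ N : psdCone n, ‖M - (N : Matrix (Fin n) (Fin n) ℝ)‖

/-- The normalized Frobenius distance between the `k`-PSD closure and the PSD cone: the supremum
of the distance to the PSD cone over the matrices of unit Frobenius norm in the `k`-PSD closure. -/
noncomputable def normalizedDist (n k : ℕ) : ℝ :=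
  sSup {d : ℝ | ∃ M ∈ kPSDClosure n k, ‖M‖ = 1 ∧ d = distPSD M}

/-- The distance to the PSD cone is at most the norm, since the zero matrix is PSD. -/
theorem distPSD_le_norm {n : ℕ} (M : Matrix (Fin n) (Fin n) ℝ) : distPSD M ≤ ‖M‖ := by
  have h0 : (0 : Matrix (Fin n) (Fin n) ℝ) ∈ psdCone n := Matrix.PosSemidef.zero
  have hb : BddBelow (Set.range fun N : psdCone n => ‖M - (N : Matrix (Fin n) (Fin n) ℝ)‖) :=
    ⟨0, by rintro _ ⟨N, rfl⟩; exact norm_nonneg _⟩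
  simpa [distPSD] using ciInf_le hb ⟨0, h0⟩

/-- The supremum in `normalizedDist` is over a bounded set. -/
theorem bddAbove_normalizedDist (n k : ℕ) :
    BddAbove {d : ℝ | ∃ M ∈ kPSDClosure n k, ‖M‖ = 1 ∧ d = distPSD M} :=
  ⟨1, by rintro _ ⟨M, -, hM, rfl⟩; exact hM ▸ distPSD_le_norm M⟩

/-!
A random family of `93 k` sign vectors in `ℝᵏ` has no badly concentrated subfamily of size `k`:
with positive probability any `k` of them satisfy `‖∑ u j • x j‖² ≤ 73 k ∑ u j²`. Extending the
family by zero vectors to the index set `Fin n`, with `D` the diagonal indicator matrix of the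
nonzero ones and `G` the Gram matrix, this says precisely that `M = 73 k D - G` lies in the `k`-PSD
closure. On the other hand there are `93` times more vectors than dimensions, so Welch's inequality
makes `‖G‖` large, and `M` correlates very negatively with the PSD matrix `G`. As `tr (G N) ≥ 0`
for `N` PSD, the Cauchy-Schwarz inequality `-tr (G M) ≤ tr (G (N - M)) ≤ ‖G‖ ‖M - N‖` keeps `M` away
from the PSD cone, at a distance proportional to `‖M‖` with a factor independent of `n` and `k`.

The random bound comes from the exponential moments of `⟪x, z⟫ ^ 2` for `z` in a net of the unit
ball. No union bound over the subfamilies `J` is needed: the single random variable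
`∏ j, (1 + s j * f j)` dominates `∏ j ∈ J, s j * f j` for all `J` simultaneously.
-/

open Finset Module
open scoped RealInnerProductSpace Matrix

section Frobenius

variable {m n : Type*} [Fintype m] [Fintype n]

theorem frobenius_norm_sq (M : Matrix m n ℝ) : ‖M‖ ^ 2 = ∑ i, ∑ j, M i j ^ 2 := by
  rw [Matrix.frobenius_norm_def, ← Real.sqrt_eq_rpow, Real.sq_sqrt (by positivity)]
  simp

theorem trace_transpose_mul_eq_sum (M N : Matrix m n ℝ) :
    (Mᵀ * N).trace = ∑ i, ∑ j, M i j * N i j := by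
  simp only [Matrix.trace, Matrix.diag_apply, Matrix.mul_apply, Matrix.transpose_apply]
  exact sum_comm

theorem trace_transpose_mul_self (M : Matrix m n ℝ) : (Mᵀ * M).trace = ‖M‖ ^ 2 := by
  rw [frobenius_norm_sq, trace_transpose_mul_eq_sum]
  simp only [sq]

theorem abs_trace_transpose_mul_le (M N : Matrix m n ℝ) : |(Mᵀ * N).trace| ≤ ‖M‖ * ‖N‖ := by
  apply abs_le_of_sq_le_sq _ (by positivity)
  rw [mul_pow, frobenius_norm_sq, frobenius_norm_sq, trace_transpose_mul_eq_sum]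
  simp only [← Fintype.sum_prod_type']
  exact sum_mul_sq_le_sq_mul_sq _ _ _

theorem frobenius_norm_sub_sq (M N : Matrix m n ℝ) :
    ‖M - N‖ ^ 2 = ‖M‖ ^ 2 - 2 * (Mᵀ * N).trace + ‖N‖ ^ 2 := by
  simp only [frobenius_norm_sq, trace_transpose_mul_eq_sum, mul_sum, ← sum_sub_distrib,
    ← sum_add_distrib, Matrix.sub_apply, sub_sq, mul_assoc]

theorem frobenius_norm_diagonal_sq [DecidableEq m] (d : m → ℝ) :
    ‖Matrix.diagonal d‖ ^ 2 = ∑ i, d i ^ 2 := by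
  simp [Matrix.frobenius_norm_diagonal, EuclideanSpace.norm_sq_eq]

theorem frobenius_norm_one_sq [DecidableEq m] : ‖(1 : Matrix m m ℝ)‖ ^ 2 = Fintype.card m := by
  rw [← trace_transpose_mul_self, Matrix.transpose_one, Matrix.one_mul, Matrix.trace_one]

theorem norm_mul_transpose_self (M : Matrix m n ℝ) : ‖M * Mᵀ‖ = ‖Mᵀ * M‖ := by
  rw [← sq_eq_sq₀ (norm_nonneg _) (norm_nonneg _), ← trace_transpose_mul_self,
    ← trace_transpose_mul_self]
  simp only [Matrix.transpose_mul, Matrix.transpose_transpose]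
  rw [Matrix.mul_assoc, Matrix.trace_mul_comm, Matrix.mul_assoc, Matrix.mul_assoc, Matrix.mul_assoc]

open scoped MatrixOrder Matrix.Norms.L2Operator in
theorem trace_mul_nonneg_of_posSemidef {H N : Matrix m m ℝ}
    (hH : H.PosSemidef) (hN : N.PosSemidef) : 0 ≤ (H * N).trace := by
  classical
  obtain ⟨B, rfl⟩ := CStarAlgebra.nonneg_iff_eq_star_mul_self.mp hH.nonneg
  rw [Matrix.mul_assoc, Matrix.trace_mul_comm]
  exact (hN.mul_mul_conjTranspose_same B).trace_nonneg

end Frobenius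

section Welch

variable {n E : Type*} [Fintype n] [NormedAddCommGroup E] [InnerProductSpace ℝ E]

theorem trace_gram (x : n → E) :
    (Matrix.gram ℝ x).trace = ∑ i, ‖x i‖ ^ 2 := by
  simp [Matrix.trace]

theorem sq_sum_norm_sq_le_finrank_mul_norm_gram_sq [FiniteDimensional ℝ E] (x : n → E) :
    (∑ i, ‖x i‖ ^ 2) ^ 2 ≤ finrank ℝ E * ‖Matrix.gram ℝ x‖ ^ 2 := by
  let M : Matrix (Fin (finrank ℝ E)) n ℝ := .of fun i j => (stdOrthonormalBasis ℝ E).repr (x j) i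
  have hgram : Matrix.gram ℝ x = Mᵀ * M := Matrix.gram_eq_conjTranspose_mul _ x
  let I : Matrix (Fin (finrank ℝ E)) (Fin (finrank ℝ E)) ℝ := 1
  calc (∑ i, ‖x i‖ ^ 2) ^ 2
    _ = (M * Mᵀ).trace ^ 2 := by rw [← trace_gram, hgram, Matrix.trace_mul_comm]
    _ = |(Iᵀ * (M * Mᵀ)).trace| ^ 2 := by
      rw [sq_abs, Matrix.transpose_one, Matrix.one_mul]
    _ ≤ (‖I‖ * ‖M * Mᵀ‖) ^ 2 := pow_le_pow_left₀ (abs_nonneg _) (abs_trace_transpose_mul_le _ _) 2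
    _ = finrank ℝ E * ‖Matrix.gram ℝ x‖ ^ 2 := by
      rw [mul_pow, frobenius_norm_one_sq, Fintype.card_fin, norm_mul_transpose_self, hgram]

end Welch

section Net

variable {E : Type*} [NormedAddCommGroup E] [NormedSpace ℝ E] [FiniteDimensional ℝ E]

theorem card_le_of_half_separated_unitBall {T : Finset E} (hT : ∀ z ∈ T, ‖z‖ ≤ 1)
    (hsep : ∀ z ∈ T, ∀ w ∈ T, z ≠ w → 1 / 2 ≤ ‖z - w‖) : #T ≤ 5 ^ finrank ℝ E := by
  classical
  have hinj : Function.Injective fun z : E => (2 : ℝ) • z := smul_right_injective E two_ne_zero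
  rw [← card_image_of_injective T hinj]
  apply Besicovitch.card_le_of_separated
  · simp only [forall_mem_image, norm_smul, Real.norm_ofNat]
    intro z hz
    linarith [hT z hz]
  · simp only [forall_mem_image, ← smul_sub, norm_smul, Real.norm_ofNat]
    intro z hz w hw hzw
    linarith [hsep z hz w hw (ne_of_apply_ne _ hzw)]

variable (E) in
theorem exists_half_net_unitBall :
    ∃ T : Finset E, #T ≤ 5 ^ finrank ℝ E ∧ (∀ z ∈ T, ‖z‖ ≤ 1) ∧
      ∀ v : E, ‖v‖ ≤ 1 → ∃ z ∈ T, ‖v - z‖ ≤ 1 / 2 := by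
  classical
  let separated : Set (Finset E) := {T | (∀ z ∈ T, ‖z‖ ≤ 1) ∧
    ∀ z ∈ T, ∀ w ∈ T, z ≠ w → 1 / 2 ≤ ‖z - w‖}
  have hcard : ∀ T ∈ separated, #T ≤ 5 ^ finrank ℝ E := fun T hT =>
    card_le_of_half_separated_unitBall hT.1 hT.2
  have hfinite : (card '' separated).Finite :=
    (Set.finite_Iic (5 ^ finrank ℝ E)).subset (Set.image_subset_iff.mpr hcard)
  obtain ⟨T, hT, hmax⟩ : ∃ T, MaximalFor (· ∈ separated) card T :=
    Set.Finite.exists_maximalFor' _ _ hfinite ⟨∅, by simp [separated]⟩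
  refine ⟨T, hcard T hT, hT.1, fun v hv => ?_⟩
  by_contra! hfar
  have hvT : v ∉ T := fun hvT => absurd (hfar v hvT) (by norm_num)
  have hinsert : insert v T ∈ separated := by
    refine ⟨by simpa [hv] using hT.1, fun z hz w hw hzw => ?_⟩
    obtain rfl | hzT := mem_insert.mp hz <;> obtain rfl | hwT := mem_insert.mp hw
    · exact absurd rfl hzw
    · exact (hfar w hwT).le
    · exact norm_sub_rev z w ▸ (hfar z hzT).le
    · exact hT.2 z hzT w hwT hzw
  have hgrow := hmax hinsert (card_le_card (subset_insert v T))
  rw [card_insert_of_notMem hvT] at hgrow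
  exact Nat.not_succ_le_self _ hgrow

end Net

section Synthesis

variable {E : Type*} [NormedAddCommGroup E] [InnerProductSpace ℝ E]

theorem one_sub_mul_norm_le_of_net {T : Set E} {δ a : ℝ}
    (hT : ∀ v : E, ‖v‖ ≤ 1 → ∃ z ∈ T, ‖v - z‖ ≤ δ) {p : E} (ha : ∀ z ∈ T, ⟪p, z⟫ ≤ a) :
    (1 - δ) * ‖p‖ ≤ a := by
  let v : E := ‖p‖⁻¹ • p
  have hv : ‖v‖ ≤ 1 := by simpa [v, norm_smul] using inv_mul_le_one (a := ‖p‖)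
  have hpv : ⟪p, v⟫ = ‖p‖ := by
    rw [real_inner_smul_right, real_inner_self_eq_norm_sq, sq, ← mul_assoc, inv_mul_mul_self]
  obtain ⟨z, hz, hvz⟩ := hT v hv
  have herror : ⟪p, v - z⟫ ≤ ‖p‖ * δ :=
    (real_inner_le_norm _ _).trans (mul_le_mul_of_nonneg_left hvz (norm_nonneg p))
  rw [inner_sub_right, hpv] at herror
  linarith [ha z hz]

theorem sq_norm_sum_smul_le_of_net {ι : Type*} {T : Set E} {δ A : ℝ} (hδ : δ ≤ 1)
    (hT : ∀ v : E, ‖v‖ ≤ 1 → ∃ z ∈ T, ‖v - z‖ ≤ δ) {J : Finset ι} {x : ι → E}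
    (hA : ∀ z ∈ T, ∑ j ∈ J, ⟪x j, z⟫ ^ 2 ≤ A) (u : ι → ℝ) :
    (1 - δ) ^ 2 * ‖∑ j ∈ J, u j • x j‖ ^ 2 ≤ A * ∑ j ∈ J, u j ^ 2 := by
  have hbound : ∀ z ∈ T, ⟪∑ j ∈ J, u j • x j, z⟫ ≤ √(A * ∑ j ∈ J, u j ^ 2) := by
    intro z hz
    apply Real.le_sqrt_of_sq_le
    simp only [sum_inner, real_inner_smul_left]
    calc (∑ j ∈ J, u j * ⟪x j, z⟫) ^ 2
      _ ≤ (∑ j ∈ J, u j ^ 2) * ∑ j ∈ J, ⟪x j, z⟫ ^ 2 := sum_mul_sq_le_sq_mul_sq _ _ _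
      _ ≤ A * ∑ j ∈ J, u j ^ 2 := by
        rw [mul_comm]
        gcongr
        exact hA z hz
  have hA0 : 0 ≤ A := by
    obtain ⟨z, hz, -⟩ := hT 0 (by simp)
    exact (sum_nonneg fun j _ => sq_nonneg _).trans (hA z hz)
  rw [← mul_pow, ← Real.le_sqrt (by have := sub_nonneg.2 hδ; positivity) (by positivity)]
  exact one_sub_mul_norm_le_of_net hT hbound

end Synthesis

theorem exists_forall_prod_le {ι Ω τ : Type*} [Fintype ι] [Fintype Ω] [Nonempty Ω]
    (T : Finset τ) (f : τ → Ω → ℝ) (hf : ∀ t ω, 0 ≤ f t ω)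
    {B : ℝ} (hB : ∀ t ∈ T, ∑ ω, f t ω ≤ Fintype.card Ω * B) {s : ι → ℝ} (hs : ∀ j, 0 ≤ s j) :
    ∃ ω : ι → Ω, ∀ t ∈ T, ∀ J : Finset ι,
      ∏ j ∈ J, s j * f t (ω j) ≤ #T * Real.exp (B * ∑ j, s j) := by
  classical
  have hsf : ∀ t ω j, 0 ≤ s j * f t ω := fun t ω j => mul_nonneg (hs j) (hf t ω)
  have hsum : ∀ t ∈ T, ∑ ω : ι → Ω, ∏ j, (1 + s j * f t (ω j)) ≤
      ∑ _ω : ι → Ω, Real.exp (B * ∑ j, s j) := by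
    intro t ht
    calc ∑ ω : ι → Ω, ∏ j, (1 + s j * f t (ω j))
      _ = ∏ j, ∑ ω, (1 + s j * f t ω) := by
        rw [prod_univ_sum, Fintype.piFinset_univ]
      _ ≤ ∏ j, Fintype.card Ω * Real.exp (B * s j) := by
        refine prod_le_prod (fun j _ => sum_nonneg fun ω _ => ?_) fun j _ => ?_
        · linarith [hsf t ω j]
        rw [sum_add_distrib, ← mul_sum, sum_const, card_univ, nsmul_one]
        calc Fintype.card Ω + s j * ∑ ω, f t ω
          _ ≤ Fintype.card Ω + s j * (Fintype.card Ω * B) := by gcongr; exacts [hs j, hB t ht]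
          _ = Fintype.card Ω * (B * s j + 1) := by ring
          _ ≤ Fintype.card Ω * Real.exp (B * s j) := by gcongr; exact Real.add_one_le_exp _
      _ = ∑ _ω : ι → Ω, Real.exp (B * ∑ j, s j) := by
        rw [prod_mul_distrib, ← Real.exp_sum, ← mul_sum]
        simp
  obtain ⟨ω, -, hω⟩ := exists_le_of_sum_le (s := (univ : Finset (ι → Ω))) univ_nonempty
    (f := fun ω => ∑ t ∈ T, ∏ j, (1 + s j * f t (ω j)))
    (g := fun _ => ∑ _t ∈ T, Real.exp (B * ∑ j, s j))
    (by rw [sum_comm, sum_comm (t := T)]; exact sum_le_sum hsum)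
  refine ⟨ω, fun t ht J => ?_⟩
  calc ∏ j ∈ J, s j * f t (ω j)
    _ = ∏ j, if j ∈ J then s j * f t (ω j) else 1 := by rw [prod_ite_mem, univ_inter]
    _ ≤ ∏ j, (1 + s j * f t (ω j)) :=
      prod_le_prod (fun j _ => by split_ifs <;> simp [hsf]) fun j _ => by
        split_ifs <;> linarith [hsf t (ω j) j]
    _ ≤ ∑ t ∈ T, ∏ j, (1 + s j * f t (ω j)) :=
      single_le_sum (f := fun t => ∏ j, (1 + s j * f t (ω j)))
        (fun t _ => prod_nonneg fun j _ => by linarith [hsf t (ω j) j]) ht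
    _ ≤ #T * Real.exp (B * ∑ j, s j) := by simpa using hω

section ExponentialMoments

open ProbabilityTheory MeasureTheory Real

theorem integral_exp_mul_sq_gaussianReal {q : ℝ} (hq : q < 1) :
    ∫ x, exp (q * x ^ 2 / 2) ∂gaussianReal 0 1 = (√(1 - q))⁻¹ := by
  have hdensity (x : ℝ) : gaussianPDFReal 0 1 x • exp (q * x ^ 2 / 2) =
      (√(2 * π))⁻¹ * exp (-((1 - q) / 2) * x ^ 2) := by
    rw [gaussianPDFReal_def, smul_eq_mul, mul_assoc, ← exp_add]
    simp only [NNReal.coe_one, mul_one, sub_zero]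
    congr 2
    ring
  have hπ : π / ((1 - q) / 2) = 2 * π * (1 - q)⁻¹ := by
    have := sub_pos.2 hq
    field_simp
  rw [integral_gaussianReal_eq_integral_smul one_ne_zero]
  simp only [hdensity]
  rw [integral_const_mul, integral_gaussian, hπ, sqrt_mul (x := 2 * π) (by positivity), sqrt_inv,
    inv_mul_cancel_left₀ (by positivity)]

theorem integral_exp_mul_gaussianReal (t : ℝ) :
    ∫ x, exp (t * x) ∂gaussianReal 0 1 = exp (t ^ 2 / 2) := by
  simpa [mgf] using congrFun (mgf_id_gaussianReal (μ := 0) (v := 1)) t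

-- `exp (t ^ 2 / 2)` is the Gaussian mean of `exp (t * x)`, which linearizes the exponent in `X`.
theorem sum_exp_mul_sq_le_of_subgaussian {Ω : Type*} [Fintype Ω] {X : Ω → ℝ} {N q l : ℝ}
    (hX : ∀ a, ∑ ω, exp (a * X ω) ≤ N * exp (a ^ 2 * q / 2)) (hl : 0 ≤ l) (hlq : 2 * l * q < 1) :
    ∑ ω, exp (l * X ω ^ 2) ≤ N / √(1 - 2 * l * q) := by
  have hint : Integrable (fun x => exp (2 * l * q * x ^ 2 / 2)) (gaussianReal 0 1) := by
    apply Integrable.of_integral_ne_zero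
    have := sub_pos.2 hlq
    rw [integral_exp_mul_sq_gaussianReal hlq]
    positivity
  calc ∑ ω, exp (l * X ω ^ 2)
    _ = ∑ ω, ∫ x, exp (√(2 * l) * X ω * x) ∂gaussianReal 0 1 := by
      refine sum_congr rfl fun ω _ => ?_
      rw [integral_exp_mul_gaussianReal, mul_pow, sq_sqrt (by positivity)]
      ring_nf
    _ = ∫ x, ∑ ω, exp (√(2 * l) * x * X ω) ∂gaussianReal 0 1 := by
      rw [← integral_finsetSum _ fun ω _ => integrable_exp_mul_gaussianReal _]
      simp only [mul_right_comm]
    _ ≤ ∫ x, N * exp (2 * l * q * x ^ 2 / 2) ∂gaussianReal 0 1 := by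
      refine integral_mono_of_nonneg (.of_forall fun x => by positivity) (hint.const_mul N)
        (.of_forall fun x => (hX _).trans_eq ?_)
      rw [mul_pow, sq_sqrt (by positivity)]
      ring_nf
    _ = N / √(1 - 2 * l * q) := by
      rw [integral_const_mul, integral_exp_mul_sq_gaussianReal hlq, div_eq_mul_inv]

end ExponentialMoments

section Signs

open Real

variable {κ : Type*} [Fintype κ]

theorem sum_units_exp_mul_le (a : ℝ) : ∑ e : ℤˣ, exp (a * (e : ℤ)) ≤ 2 * exp (a ^ 2 / 2) := by
  rw [UnitsInt.univ, sum_pair (by decide)]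
  have hcosh := cosh_le_exp_half_sq a
  rw [cosh_eq] at hcosh
  simp only [Units.val_one, Units.val_neg, Int.cast_one, Int.cast_neg, mul_one, mul_neg]
  linarith

/-- The vector with coordinates `±1` and sign pattern `ε`. For `ε` uniformly distributed this is a
Rademacher vector; signs are units of `ℤ`, so that sums over all patterns are finite sums over
`κ → ℤˣ`. -/
noncomputable def signVec (ε : κ → ℤˣ) : EuclideanSpace ℝ κ :=
  WithLp.toLp 2 fun i => ((ε i : ℤ) : ℝ)

theorem norm_signVec_sq (ε : κ → ℤˣ) : ‖signVec ε‖ ^ 2 = Fintype.card κ := by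
  simp [EuclideanSpace.norm_sq_eq, signVec, ← Int.cast_pow, ← Units.val_pow_eq_pow_val]

theorem sum_exp_mul_inner_signVec_le [DecidableEq κ] (a : ℝ) (w : EuclideanSpace ℝ κ) :
    ∑ ε : κ → ℤˣ, exp (a * ⟪signVec ε, w⟫) ≤ 2 ^ Fintype.card κ * exp (a ^ 2 * ‖w‖ ^ 2 / 2) := by
  have hfactor (ε : κ → ℤˣ) : exp (a * ⟪signVec ε, w⟫) = ∏ i, exp (a * w i * (ε i : ℤ)) := by
    rw [← exp_sum]
    simp [PiLp.inner_apply, signVec, mul_sum, mul_assoc]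
  simp only [hfactor]
  calc ∑ ε : κ → ℤˣ, ∏ i, exp (a * w i * (ε i : ℤ))
    _ = ∏ i, ∑ e : ℤˣ, exp (a * w i * (e : ℤ)) := by rw [prod_univ_sum, Fintype.piFinset_univ]
    _ ≤ ∏ i, (2 * exp ((a * w i) ^ 2 / 2)) :=
      prod_le_prod (fun i _ => by positivity) fun i _ => sum_units_exp_mul_le _
    _ = 2 ^ Fintype.card κ * exp (a ^ 2 * ‖w‖ ^ 2 / 2) := by
      rw [prod_mul_distrib, prod_const, card_univ, ← exp_sum, EuclideanSpace.norm_sq_eq, mul_sum,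
        sum_div]
      simp [mul_pow]

theorem sum_exp_mul_inner_signVec_sq_le [DecidableEq κ] {l : ℝ} (hl : 0 ≤ l) (hl' : l < 1 / 2)
    {w : EuclideanSpace ℝ κ} (hw : ‖w‖ ≤ 1) :
    ∑ ε : κ → ℤˣ, exp (l * ⟪signVec ε, w⟫ ^ 2) ≤ 2 ^ Fintype.card κ * (√(1 - 2 * l))⁻¹ := by
  have hw2 : ‖w‖ ^ 2 ≤ 1 := pow_le_one₀ (norm_nonneg w) hw
  have hsubgaussian (a : ℝ) :
      ∑ ε : κ → ℤˣ, exp (a * ⟪signVec ε, w⟫) ≤ 2 ^ Fintype.card κ * exp (a ^ 2 * 1 / 2) :=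
    (sum_exp_mul_inner_signVec_le a w).trans (by gcongr)
  simpa only [mul_one, div_eq_mul_inv] using
    sum_exp_mul_sq_le_of_subgaussian hsubgaussian hl (by linarith)

variable (ι : Type*) [Fintype ι]

theorem exists_signs_sum_inner_sq_le {T : Finset (EuclideanSpace ℝ κ)}
    (hT : ∀ z ∈ T, ‖z‖ ≤ 1) {l σ : ℝ} (hl : 0 < l) (hl' : l < 1 / 2) (hσ : 0 < σ) :
    ∃ ε : ι → κ → ℤˣ, ∀ z ∈ T, ∀ J : Finset ι, ∑ j ∈ J, ⟪signVec (ε j), z⟫ ^ 2 ≤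
      (log #T + Fintype.card ι * σ / √(1 - 2 * l) - #J * log σ) / l := by
  classical
  obtain ⟨ε, hε⟩ := exists_forall_prod_le T
    (fun z (ε : κ → ℤˣ) => exp (l * ⟪signVec ε, z⟫ ^ 2)) (fun _ _ => (exp_pos _).le)
    (fun z hz => by simpa using sum_exp_mul_inner_signVec_sq_le hl.le hl' (hT z hz))
    (s := fun _ : ι => σ) (fun _ => hσ.le)
  refine ⟨ε, fun z hz J => ?_⟩
  have hprod : σ ^ #J * exp (l * ∑ j ∈ J, ⟪signVec (ε j), z⟫ ^ 2) ≤
      #T * exp (Fintype.card ι * σ / √(1 - 2 * l)) := by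
    calc σ ^ #J * exp (l * ∑ j ∈ J, ⟪signVec (ε j), z⟫ ^ 2)
      _ = ∏ j ∈ J, σ * exp (l * ⟪signVec (ε j), z⟫ ^ 2) := by
        rw [mul_sum, exp_sum, ← prod_const, ← prod_mul_distrib]
      _ ≤ #T * exp ((√(1 - 2 * l))⁻¹ * ∑ _j : ι, σ) := hε z hz J
      _ = #T * exp (Fintype.card ι * σ / √(1 - 2 * l)) := by
        rw [sum_const, card_univ, nsmul_eq_mul, mul_comm (√_)⁻¹, div_eq_mul_inv]
  have hTpos : (0 : ℝ) < #T := by exact_mod_cast card_pos.mpr ⟨z, hz⟩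
  have hlog := log_le_log (by positivity) hprod
  rw [log_mul (by positivity) (by positivity), log_exp, log_pow,
    log_mul (by positivity) (by positivity), log_exp] at hlog
  rw [le_div_iff₀ hl]
  linarith

variable (κ) in
theorem exists_signs_sq_norm_sum_smul_le {l σ : ℝ} (hl : 0 < l) (hl' : l < 1 / 2) (hσ : 0 < σ) :
    ∃ ε : ι → κ → ℤˣ, ∀ (J : Finset ι) (u : ι → ℝ), ‖∑ j ∈ J, u j • signVec (ε j)‖ ^ 2 ≤
      4 * ((Fintype.card κ * log 5 + Fintype.card ι * σ / √(1 - 2 * l) - #J * log σ) / l) *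
        ∑ j ∈ J, u j ^ 2 := by
  obtain ⟨T, hcard, hT, hnet⟩ := exists_half_net_unitBall (EuclideanSpace ℝ κ)
  have hlogcard : log #T ≤ Fintype.card κ * log 5 := by
    have hTpos : (0 : ℝ) < #T := by
      obtain ⟨z, hz, -⟩ := hnet 0 (by simp)
      exact_mod_cast card_pos.mpr ⟨z, hz⟩
    rw [← log_pow, ← finrank_euclideanSpace (𝕜 := ℝ)]
    exact log_le_log hTpos (by exact_mod_cast hcard)
  obtain ⟨ε, hε⟩ := exists_signs_sum_inner_sq_le ι hT hl hl' hσ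
  refine ⟨ε, fun J u => ?_⟩
  have hsum : ∀ z ∈ (T : Set (EuclideanSpace ℝ κ)), ∑ j ∈ J, ⟪signVec (ε j), z⟫ ^ 2 ≤
      (Fintype.card κ * log 5 + Fintype.card ι * σ / √(1 - 2 * l) - #J * log σ) / l :=
    fun z hz => (hε z hz J).trans (by gcongr)
  have hnorm := sq_norm_sum_smul_le_of_net (by norm_num) hnet hsum u
  linarith

theorem log_2325_le : log 2325 ≤ 194 / 25 := by
  have hpow : (2325 : ℝ) ^ 25 ≤ exp 1 ^ 194 := calc
    (2325 : ℝ) ^ 25 ≤ 2.7182818283 ^ 194 := by norm_num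
    _ ≤ exp 1 ^ 194 := by gcongr; exact exp_one_gt_d9.le
  have hlog := log_le_log (by positivity) hpow
  simp only [log_pow, log_exp, mul_one, Nat.cast_ofNat] at hlog
  linarith

variable {ι}

theorem exists_signs_sq_norm_sum_smul_le_mul_card (hι : Fintype.card ι = 93 * Fintype.card κ) :
    ∃ ε : ι → κ → ℤˣ, ∀ J : Finset ι, #J ≤ Fintype.card κ → ∀ u : ι → ℝ,
      ‖∑ j ∈ J, u j • signVec (ε j)‖ ^ 2 ≤ 73 * Fintype.card κ * ∑ j ∈ J, u j ^ 2 := by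
  -- `l = 12 / 25` gives `1 / √(1 - 2 * l) = 5`, and then `σ = 1 / (93 * 5)` makes the middle term
  -- `Fintype.card ι * σ / √(1 - 2 * l)` equal to the dimension.
  obtain ⟨ε, hε⟩ := exists_signs_sq_norm_sum_smul_le κ ι (l := 12 / 25) (σ := 1 / 465)
    (by norm_num) (by norm_num) (by norm_num)
  refine ⟨ε, fun J hcard u => (hε J u).trans ?_⟩
  refine mul_le_mul_of_nonneg_right ?_ (sum_nonneg fun j _ => sq_nonneg (u j))
  have hsqrt : √(1 - 2 * (12 / 25) : ℝ) = 1 / 5 := by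
    rw [sqrt_eq_iff_mul_self_eq_of_pos] <;> norm_num
  have hcard' : (#J : ℝ) * log 465 ≤ Fintype.card κ * log 465 := by
    gcongr
  have hlog : log 5 + log 465 ≤ 194 / 25 := calc
    log 5 + log 465 = log 2325 := by rw [← log_mul] <;> norm_num
    _ ≤ 194 / 25 := log_2325_le
  have hcardlog := mul_le_mul_of_nonneg_left hlog (Nat.cast_nonneg (α := ℝ) (Fintype.card κ))
  rw [hsqrt, hι, one_div, log_inv, Nat.cast_mul, Nat.cast_ofNat]
  linarith

theorem exists_padded_signVec_family {α : Type*} [DecidableEq α] {I : Finset α}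
    (hI : #I = 93 * Fintype.card κ) :
    ∃ x : α → EuclideanSpace ℝ κ, (∀ i, ‖x i‖ ^ 2 = if i ∈ I then (Fintype.card κ : ℝ) else 0) ∧
      ∀ J, #J ≤ Fintype.card κ → ∀ u : α → ℝ, ‖∑ j ∈ J, u j • x j‖ ^ 2 ≤
        ∑ j ∈ J, (if j ∈ I then 73 * (Fintype.card κ : ℝ) else 0) * u j ^ 2 := by
  obtain ⟨ε, hε⟩ := exists_signs_sq_norm_sum_smul_le_mul_card (ι := I) (by simpa using hI)
  let x (i : α) : EuclideanSpace ℝ κ := if hi : i ∈ I then signVec (ε ⟨i, hi⟩) else 0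
  have hx (i : I) : x i = signVec (ε i) := by simp [x]
  refine ⟨x, fun i => ?_, fun J hJ u => ?_⟩
  · by_cases hi : i ∈ I <;> simp [x, hi, norm_signVec_sq]
  have hsupport : ∑ j ∈ J, u j • x j = ∑ j ∈ J.subtype (· ∈ I), u j • x j := by
    rw [sum_subtype_eq_sum_filter (fun j => u j • x j), sum_filter_of_ne]
    intro j _ hj
    by_contra hjI
    simp [x, hjI] at hj
  have hcard : #(J.subtype (· ∈ I)) ≤ Fintype.card κ := by
    rw [card_subtype]
    exact (card_filter_le _ _).trans hJ
  rw [hsupport]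
  simp only [hx, ite_mul, zero_mul]
  rw [← sum_filter, ← mul_sum, ← sum_subtype_eq_sum_filter (fun j => u j ^ 2)]
  exact hε _ hcard fun j => u j

end Signs

section Distance

variable {n k : ℕ}

theorem neg_trace_mul_le_norm_mul_distPSD {H : Matrix (Fin n) (Fin n) ℝ} (hH : H.PosSemidef)
    (M : Matrix (Fin n) (Fin n) ℝ) : -(H * M).trace ≤ ‖H‖ * distPSD M := by
  have : Nonempty (psdCone n) := ⟨⟨0, Matrix.PosSemidef.zero⟩⟩
  rw [distPSD, Real.mul_iInf_of_nonneg (norm_nonneg H)]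
  refine le_ciInf fun N => ?_
  have hcs : |(H * (M - N)).trace| ≤ ‖H‖ * ‖M - N‖ := by
    conv_lhs => rw [← hH.isHermitian.eq]
    exact abs_trace_transpose_mul_le _ _
  have hN : 0 ≤ (H * (N : Matrix (Fin n) (Fin n) ℝ)).trace := trace_mul_nonneg_of_posSemidef hH N.2
  rw [Matrix.mul_sub, Matrix.trace_sub] at hcs
  linarith [neg_le_of_abs_le hcs]

theorem smul_mem_kPSDClosure {M : Matrix (Fin n) (Fin n) ℝ} (hM : M ∈ kPSDClosure n k) {c : ℝ}
    (hc : 0 ≤ c) : c • M ∈ kPSDClosure n k :=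
  ⟨hM.1.smul c, fun J hJ => (hM.2 J hJ).smul hc⟩

theorem neg_trace_mul_le_mul_normalizedDist {H M : Matrix (Fin n) (Fin n) ℝ} (hH : H.PosSemidef)
    (hM : M ∈ kPSDClosure n k) : -(H * M).trace ≤ ‖M‖ * ‖H‖ * normalizedDist n k := by
  let := Matrix.frobeniusNormedSpace (m := Fin n) (n := Fin n) (R := ℝ) (α := ℝ)
  obtain rfl | hM0 := eq_or_ne M 0
  · simp
  have hmem : distPSD (‖M‖⁻¹ • M) ≤ normalizedDist n k :=
    le_csSup (bddAbove_normalizedDist n k) ⟨_, smul_mem_kPSDClosure hM (by positivity),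
      norm_smul_inv_norm hM0, rfl⟩
  have hdist := neg_trace_mul_le_norm_mul_distPSD hH (‖M‖⁻¹ • M)
  rw [Matrix.mul_smul, Matrix.trace_smul, smul_eq_mul, ← mul_neg,
    inv_mul_le_iff₀ (norm_pos_iff.mpr hM0)] at hdist
  rw [mul_assoc]
  exact hdist.trans (by gcongr)

variable {E : Type*} [NormedAddCommGroup E] [InnerProductSpace ℝ E]

theorem diagonal_sub_gram_mem_kPSDClosure {d : Fin n → ℝ} {x : Fin n → E}
    (hx : ∀ J : Finset (Fin n), #J = k → ∀ u : Fin n → ℝ,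
      ‖∑ j ∈ J, u j • x j‖ ^ 2 ≤ ∑ j ∈ J, d j * u j ^ 2) :
    Matrix.diagonal d - Matrix.gram ℝ x ∈ kPSDClosure n k := by
  have hherm : (Matrix.diagonal d - Matrix.gram ℝ x).IsHermitian :=
    (Matrix.isHermitian_diagonal d).sub (Matrix.isHermitian_gram ℝ x)
  refine ⟨hherm, fun J hJ => .of_dotProduct_mulVec_nonneg (hherm.submatrix _) fun v => ?_⟩
  let u : Fin n → ℝ := Function.extend Subtype.val v 0
  have hu (j : J) : u j = v j := Subtype.val_injective.extend_apply v 0 j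
  have hgram := Matrix.star_dotProduct_gram_mulVec (fun j : J => x j) v v
  have hdiag : star v ⬝ᵥ Matrix.diagonal (fun j : J => d j) *ᵥ v = ∑ j : J, d j * v j ^ 2 := by
    simp only [dotProduct, Matrix.mulVec_diagonal, star_trivial]
    exact sum_congr rfl fun j _ => by ring
  have hsub : (Matrix.diagonal d - Matrix.gram ℝ x).submatrix (fun j : J => (j : Fin n))
      (fun j : J => (j : Fin n)) =
        Matrix.diagonal (fun j : J => d j) - Matrix.gram ℝ (fun j : J => x j) :=
    congrArg (· - Matrix.gram ℝ (fun j : J => x j))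
      (Matrix.submatrix_diagonal d _ Subtype.val_injective)
  rw [hsub, Matrix.sub_mulVec, dotProduct_sub, hgram, hdiag, real_inner_self_eq_norm_sq, sub_nonneg]
  simp only [← hu]
  rw [sum_coe_sort J fun j => u j • x j, sum_coe_sort J fun j => d j * u j ^ 2]
  exact hx J hJ u

theorem norm_gram_sq_sub_le_mul_normalizedDist {d : Fin n → ℝ} {x : Fin n → E}
    (hx : ∀ J : Finset (Fin n), #J = k → ∀ u : Fin n → ℝ,
      ‖∑ j ∈ J, u j • x j‖ ^ 2 ≤ ∑ j ∈ J, d j * u j ^ 2) :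
    ‖Matrix.gram ℝ x‖ ^ 2 - ∑ i, d i * ‖x i‖ ^ 2 ≤
      √((∑ i, d i ^ 2 - 2 * ∑ i, d i * ‖x i‖ ^ 2 + ‖Matrix.gram ℝ x‖ ^ 2) *
        ‖Matrix.gram ℝ x‖ ^ 2) * normalizedDist n k := by
  have htrace : ((Matrix.diagonal d)ᵀ * Matrix.gram ℝ x).trace = ∑ i, d i * ‖x i‖ ^ 2 := by
    simp [Matrix.trace]
  have hnorm : ‖Matrix.diagonal d - Matrix.gram ℝ x‖ ^ 2 =
      ∑ i, d i ^ 2 - 2 * ∑ i, d i * ‖x i‖ ^ 2 + ‖Matrix.gram ℝ x‖ ^ 2 := by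
    rw [frobenius_norm_sub_sq, frobenius_norm_diagonal_sq, htrace]
  have hpair : -(Matrix.gram ℝ x * (Matrix.diagonal d - Matrix.gram ℝ x)).trace =
      ‖Matrix.gram ℝ x‖ ^ 2 - ∑ i, d i * ‖x i‖ ^ 2 := by
    have hsymm : (Matrix.gram ℝ x)ᵀ = Matrix.gram ℝ x := Matrix.isHermitian_gram ℝ x
    rw [Matrix.mul_sub, Matrix.trace_sub, neg_sub, Matrix.trace_mul_comm _ (Matrix.diagonal d),
      ← htrace, ← trace_transpose_mul_self, hsymm, Matrix.diagonal_transpose]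
  rw [← hpair, ← hnorm, ← mul_pow, Real.sqrt_sq (by positivity)]
  exact neg_trace_mul_le_mul_normalizedDist (Matrix.posSemidef_gram ℝ x)
    (diagonal_sub_gram_mem_kPSDClosure hx)

theorem one_div_thirtySix_le_normalizedDist (hk : 0 < k) (hkn : 93 * k ≤ n) :
    1 / 36 ≤ normalizedDist n k := by
  obtain ⟨I, -, hI⟩ := exists_subset_card_eq (s := (univ : Finset (Fin n))) (n := 93 * k)
    (by simpa using hkn)
  obtain ⟨x, hnorm, hx⟩ := exists_padded_signVec_family (κ := Fin k) (I := I) (by simpa using hI)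
  let K : ℝ := k ^ 3
  let F : ℝ := ‖Matrix.gram ℝ x‖ ^ 2
  have hk' : (0 : ℝ) < k := Nat.cast_pos.mpr hk
  have hK : 0 < K := pow_pos hk' 3
  have hF : 93 ^ 2 * K ≤ F := by
    have hwelch := sq_sum_norm_sq_le_finrank_mul_norm_gram_sq x
    have hsum : ∑ i, ‖x i‖ ^ 2 = 93 * (k : ℝ) ^ 2 := by
      simp only [hnorm, sum_ite_mem, univ_inter, sum_const, hI, nsmul_eq_mul, Fintype.card_fin]
      push_cast
      ring
    rw [hsum, finrank_euclideanSpace_fin] at hwelch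
    exact le_of_mul_le_mul_left (by linarith) hk'
  have hdist := norm_gram_sq_sub_le_mul_normalizedDist (k := k) fun J hJ => hx J (by simp [hJ])
  have hcross : ∑ i, (if i ∈ I then 73 * (Fintype.card (Fin k) : ℝ) else 0) * ‖x i‖ ^ 2 =
      73 * 93 * K := by
    simp only [hnorm, ite_mul, zero_mul, mul_ite, mul_zero, sum_ite_mem, univ_inter,
      inter_self, sum_const, hI, nsmul_eq_mul, Fintype.card_fin, K]
    push_cast
    ring
  have hdiag : ∑ i, (if i ∈ I then 73 * (Fintype.card (Fin k) : ℝ) else 0) ^ 2 =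
      73 ^ 2 * 93 * K := by
    simp only [ite_pow, ne_eq, OfNat.ofNat_ne_zero, not_false_eq_true, zero_pow, sum_ite_mem,
      univ_inter, sum_const, hI, nsmul_eq_mul, Fintype.card_fin, K]
    push_cast
    ring
  rw [hcross, hdiag] at hdist
  have hsqrt : √((73 ^ 2 * 93 * K - 2 * (73 * 93 * K) + F) * F) ≤ 36 * (F - 73 * 93 * K) := by
    refine Real.sqrt_le_iff.mpr ⟨by linarith, ?_⟩
    nlinarith [mul_nonneg (sub_nonneg.mpr hF) (sub_nonneg.mpr hF)]
  have hnonneg : 0 ≤ normalizedDist n k := Real.sSup_nonneg (by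
    rintro _ ⟨M, -, -, rfl⟩
    exact Real.iInf_nonneg fun N => norm_nonneg _)
  have hmul := hdist.trans (mul_le_mul_of_nonneg_right hsqrt hnonneg)
  have hgap : 0 < F - 73 * 93 * K := by linarith
  rw [div_le_iff₀ (by norm_num)]
  exact le_of_mul_le_mul_left (by linarith) hgap

end Distance

theorem theorem4 (r : ℝ) (hr : r < 1 / 93) (n k : ℕ) (hk : 2 ≤ k) (hkn : (k : ℝ) = r * (n : ℝ)) :
    √(r - 93 * r ^ 2) / √(162 * r + 3) < normalizedDist n k := by
  have hk0 : (0 : ℝ) < r * n := by rw [← hkn]; positivity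
  have hr0 : 0 < r := pos_of_mul_pos_left hk0 n.cast_nonneg
  have hkn' : 93 * k ≤ n := by
    have : (93 * k : ℝ) ≤ n := by
      rw [hkn]
      linarith [mul_le_mul_of_nonneg_right hr.le (Nat.cast_nonneg (α := ℝ) n)]
    exact_mod_cast this
  refine lt_of_lt_of_le ?_ (one_div_thirtySix_le_normalizedDist (by omega) hkn')
  rw [← Real.sqrt_div' _ (by positivity), Real.sqrt_lt' (by norm_num), div_lt_iff₀ (by positivity)]
  nlinarith [sq_nonneg (r - 1 / 186)]
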